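/- Write $[m]=\{1,\dots,m\}$, and let $\binom{[m]}{k}$ be the family of all $k$-element subsets of $[m]$. Two families $\mathcal F,\mathcal G\subset 2^{[n]}$ are cross-intersecting if $F\cap G\neq\emptyset$ for all $F\in\mathcal F$, $G\in\mathcal G$. The covering number $\tau(\mathcal F)$ is the minimum size of a set $T\subset[n]$ with $F\cap T\ne\emptyset$ for all $F\in\mathcal F$. For $1\le i<j\le n$ let $S_{ij}(\mathcal F)=\{S_{ij}(F):F\in\mathcal F\}$, where $S_{ij}(F)=(F\setminus\{j\})\cup\{i\}$ if $j\in F$, $i\notin F$ and $(F\setminus\{j\})\cup\{i\}\notin\mathcal F$, and $S_{ij}(F)=F$ otherwise; $\mathcal F$ is initial if $S_{ij}(\mathcal F)=\mathcal F$ for all $1\le i<j\le n$. Two families of subsets of $[n]$ are isomorphic if some permutation of $[n]$ maps one onto the other. Put $$\mathcal H_s^t(n,a,b)=\Big\{A\in\tbinom{[n]}{a}: A\cap[s]\neq\emptyset,\ |A\cap[b+t-1]|\ge t\Big\}\cup\Big\{B\in\tbinom{[n]}{b}:[s]\subset B\Big\}\cup\tbinom{[b+t-1]}{b}.$$ Corollary.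 Suppose that $\mathcal F\subset\binom{[n]}{a}$ and $\mathcal G\subset\binom{[n]}{b}$ are initial cross-intersecting families with $a\ge b+t-1$ and $b\ge2$. If (1) $\tau(\mathcal F)=s\ge2$ and $\tau(\mathcal G)\ge t\ge2$, or (2) $\tau(\mathcal F)=s\ge2$ and $\tau(\mathcal G)=t\ge2$, then for $n\ge a+b$, $$|\mathcal F|+|\mathcal G|\le|\mathcal H_s^t(n,a,b)|.$$ Moreover, when $n>a+b$, equality holds if and only if $\mathcal F\cup\mathcal G$ is isomorphic to $\mathcal H_s^t(n,a,b)$. -/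

import Mathlib

namespace CrossFamilies

/-- The `k`-element subsets of `[n] = {1, …, n}`. -/
def layer (n k : ℕ) : Finset (Finset ℕ) :=
  (Finset.Icc 1 n).powersetCard k

/-- Every member of `𝓕` meets every member of `𝓖`. -/
def CrossIntersecting (𝓕 𝓖 : Finset (Finset ℕ)) : Prop :=
  ∀ F ∈ 𝓕, ∀ G ∈ 𝓖, (F ∩ G).Nonempty

/-- `T` is a cover (transversal) of `𝓕` inside `[n]`: it meets every member of `𝓕`. -/
def IsCover (n : ℕ) (𝓕 : Finset (Finset ℕ)) (T : Finset ℕ) : Prop :=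
  T ⊆ Finset.Icc 1 n ∧ ∀ F ∈ 𝓕, (F ∩ T).Nonempty

/-- The covering number of a family of subsets of `[n]`: the minimum size of a cover. For a family
of nonempty subsets of `[n]` the whole of `[n]` is a cover, so this is an attained minimum. -/
noncomputable def coveringNumber (n : ℕ) (𝓕 : Finset (Finset ℕ)) : ℕ :=
  sInf {k : ℕ | ∃ T : Finset ℕ, IsCover n 𝓕 T ∧ T.card = k}

/-- The shift of a single set `F` with respect to the family `𝓕`: replace `j` by `i` if `j ∈ F`,
`i ∉ F` and the resulting set is not already in `𝓕`. -/
def shiftSet (i j : ℕ) (𝓕 : Finset (Finset ℕ)) (F : Finset ℕ) : Finset ℕ :=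
  if j ∈ F ∧ i ∉ F ∧ (F \ {j}) ∪ {i} ∉ 𝓕 then (F \ {j}) ∪ {i} else F

/-- The shifting operation applied to a family. -/
def shift (i j : ℕ) (𝓕 : Finset (Finset ℕ)) : Finset (Finset ℕ) :=
  𝓕.image (shiftSet i j 𝓕)

/-- A family of subsets of `[n]` is initial (left-shifted) if it is fixed by all shifts. -/
def IsInitial (n : ℕ) (𝓕 : Finset (Finset ℕ)) : Prop :=
  ∀ i j : ℕ, 1 ≤ i → i < j → j ≤ n → shift i j 𝓕 = 𝓕

/-- Two families of subsets of `[n]` are isomorphic if a bijection of `[n]` onto itself carries one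
to the other. -/
def Isomorphic (n : ℕ) (𝓕 𝓗 : Finset (Finset ℕ)) : Prop :=
  ∃ σ : ℕ → ℕ, Set.BijOn σ (Set.Icc 1 n) (Set.Icc 1 n) ∧
    𝓕.image (fun F => F.image σ) = 𝓗

/-- The extremal family: the `a`-subsets of `[n]` meeting `[1, s]` and having at least `t` elements
in `[b + t - 1]`, the `b`-subsets of `[n]` containing `[1, s]`, and all `b`-subsets of
`[b + t - 1]`. -/
def extremalFamily (n a b s t : ℕ) : Finset (Finset ℕ) :=
  (layer n a).filter (fun A => (A ∩ Finset.Icc 1 s).Nonempty ∧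
      t ≤ (A ∩ Finset.Icc 1 (b + t - 1)).card)
    ∪ (layer n b).filter (fun B => Finset.Icc 1 s ⊆ B)
    ∪ layer (b + t - 1) b

end CrossFamilies

namespace CrossFamilies

/-! For shifted families the covering numbers become containments. From τ(𝓕) = s ≥ 2, every member
of 𝓕 meets [s] and 𝓕 contains all a-subsets of [a+s-1]. From τ(𝓖) ≥ t, 𝓖 contains all b-subsets of
[c], c = b+t-1, so each member of 𝓕 has at least t elements in [c]. Thus 𝓕 consists of `Large` sets.
A set is `Small` exactly when its complement is not `Large`, and the extremal family is the `Large`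
a-sets together with the `Small` b-sets.

The bound (`card_add_card_le`) is an induction on the ground set, split at its largest element.
Deletion and link inherit shiftedness and cross-intersection, the link because n > a+b leaves a
spare point, and the two layer counts obey Pascal's recursion. The induction ends at n = a+b
(complementation), at b = 0, or when [c] is the whole ground set and only the condition on [s]
remains.

Equality passes to links (`left_eq_of_card_eq`). Members of 𝓖 keep s elements in a fixed segment, so
after enough links the second family is empty and the first is all `Large` sets; shifting carries
this back up. Cross-intersection then makes every member of 𝓖 `Small`, and counting finishes. -/

open Finset

/-! ### Shifted families and their covers -/

/-- Closure under all moves replacing an element of a member by a smaller one. -/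
def Shifted (n : ℕ) (𝓕 : Finset (Finset ℕ)) : Prop :=
  ∀ F ∈ 𝓕, ∀ i j : ℕ, 1 ≤ i → i < j → j ≤ n → j ∈ F → i ∉ F → insert i (F.erase j) ∈ 𝓕

theorem IsInitial.shifted {n : ℕ} {𝓕 : Finset (Finset ℕ)} (h : IsInitial n 𝓕) : Shifted n 𝓕 := by
  intro F hF i j hi hij hj hjF hiF
  have heq : (F \ {j}) ∪ {i} = insert i (F.erase j) := by
    ext x
    simp only [mem_union, mem_sdiff, mem_singleton, mem_insert, mem_erase]
    tauto
  by_contra hcon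
  have hmem : shiftSet i j 𝓕 F ∈ 𝓕 := by
    have h1 : shiftSet i j 𝓕 F ∈ shift i j 𝓕 := mem_image_of_mem _ hF
    rwa [h i j hi hij hj] at h1
  rw [shiftSet, heq, if_pos ⟨hjF, hiF, hcon⟩] at hmem
  exact hcon hmem

theorem mem_layer {n k : ℕ} {A : Finset ℕ} : A ∈ layer n k ↔ A ⊆ Icc 1 n ∧ #A = k :=
  mem_powersetCard

theorem layer_mono {m n : ℕ} (h : m ≤ n) (k : ℕ) : layer m k ⊆ layer n k :=
  powersetCard_mono (Icc_subset_Icc_right h)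

/-- In a shifted family, elements of a member may be exchanged for smaller ones in bulk. -/
theorem Shifted.exchange {n : ℕ} {𝓕 : Finset (Finset ℕ)} (h : Shifted n 𝓕) {F W : Finset ℕ}
    (hF : F ∈ 𝓕) (hFn : F ⊆ Icc 1 n) (hW : W ⊆ Icc 1 n) (hcard : #W = #F)
    (hlt : ∀ i ∈ W \ F, ∀ j ∈ F \ W, i < j) : W ∈ 𝓕 := by
  induction hk : #(W \ F) generalizing F with
  | zero =>
    have hsub : W ⊆ F := by
      rwa [card_eq_zero, sdiff_eq_empty_iff_subset] at hk
    rwa [eq_of_subset_of_card_le hsub hcard.ge]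
  | succ k ih =>
    obtain ⟨i, hi⟩ : (W \ F).Nonempty := card_pos.1 (by omega)
    have hFW : #(F \ W) = k + 1 := by
      rw [← hk, card_sdiff_comm hcard]
    obtain ⟨j, hj⟩ : (F \ W).Nonempty := card_pos.1 (by omega)
    have hij := hlt i hi j hj
    rw [mem_sdiff] at hi hj
    have hi1 := mem_Icc.1 (hW hi.1)
    have hj1 := mem_Icc.1 (hFn hj.1)
    have hmem := h F hF i j hi1.1 hij hj1.2 hj.1 hi.2
    refine ih hmem ?_ ?_ ?_ ?_
    · exact insert_subset (hW hi.1) ((erase_subset _ _).trans hFn)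
    · rw [card_insert_of_notMem (fun hc => hi.2 (mem_of_mem_erase hc)), card_erase_add_one hj.1,
        hcard]
    · intro x hx y hy
      refine hlt x ?_ y ?_
      · simp only [mem_sdiff, mem_insert, mem_erase] at hx ⊢
        refine ⟨hx.1, fun hxF => hx.2 (Or.inr ⟨?_, hxF⟩)⟩
        rintro rfl
        exact hj.2 hx.1
      · simp only [mem_sdiff, mem_insert, mem_erase] at hy ⊢
        rcases hy with ⟨rfl | hy, hyW⟩
        · exact absurd hi.1 hyW
        · exact ⟨hy.2, hyW⟩
    · have : W \ insert i (F.erase j) = (W \ F).erase i := by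
        ext x
        simp only [mem_sdiff, mem_insert, mem_erase]
        constructor
        · rintro ⟨hx, hx2⟩
          refine ⟨fun h => hx2 (Or.inl h), hx, fun hxF => hx2 (Or.inr ⟨?_, hxF⟩)⟩
          rintro rfl
          exact hj.2 hx
        · rintro ⟨hxi, hx, hxF⟩
          exact ⟨hx, fun h => h.elim hxi fun h => hxF h.2⟩
      rw [this, card_erase_of_mem (mem_sdiff.2 hi), hk]
      rfl

/-- If a shifted family is not covered by fewer than `r + 1` points, it contains all sets in
`[k + r]`. -/
theorem Shifted.layer_subset_of_lt_coveringNumber {n k r : ℕ} {𝓕 : Finset (Finset ℕ)}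
    (h : Shifted n 𝓕) (h𝓕 : 𝓕 ⊆ layer n k) (hr : r < coveringNumber n 𝓕) :
    k + r ≤ n ∧ layer (k + r) k ⊆ 𝓕 := by
  have hrn : r ≤ n := by
    -- The infimum of the empty set is 0, so a positive covering number guarantees that a cover
    -- exists.
    have hne := Nat.nonempty_of_pos_sInf (show 0 < sInf _ from (Nat.zero_le r).trans_lt hr)
    obtain ⟨T, hT, hTc⟩ := Nat.sInf_mem hne
    have h1 := card_le_card hT.1
    rw [Nat.card_Icc, hTc] at h1
    have h2 : r < sInf _ := hr
    omega
  have hnot : ¬ IsCover n 𝓕 (Icc 1 r) := by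
    intro hc
    have h1 : coveringNumber n 𝓕 ≤ r := Nat.sInf_le ⟨Icc 1 r, hc, by simp⟩
    omega
  obtain ⟨F, hF, hFr⟩ : ∃ F ∈ 𝓕, ∀ x ∈ F, r < x := by
    by_contra! hcon
    refine hnot ⟨Icc_subset_Icc_right hrn, fun F hF => ?_⟩
    obtain ⟨x, hx, hxr⟩ := hcon F hF
    have := mem_Icc.1 ((mem_layer.1 (h𝓕 hF)).1 hx)
    exact ⟨x, mem_inter.2 ⟨hx, mem_Icc.2 ⟨this.1, hxr⟩⟩⟩
  have hFl := mem_layer.1 (h𝓕 hF)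
  have hkr : k + r ≤ n := by
    have hsub : F ⊆ Icc (r + 1) n := fun x hx =>
      mem_Icc.2 ⟨hFr x hx, (mem_Icc.1 (hFl.1 hx)).2⟩
    have h1 := card_le_card hsub
    rw [Nat.card_Icc, hFl.2] at h1
    omega
  refine ⟨hkr, fun W hW => ?_⟩
  have hIn : Icc (r + 1) (k + r) ⊆ Icc 1 n := Icc_subset_Icc (by omega) hkr
  have hIc : #(Icc (r + 1) (k + r)) = k := by rw [Nat.card_Icc]; omega
  -- A member avoiding [r] compresses to the first k points after r. Points of [k+r] outside this
  -- block are at most r, so the block in turn exchanges to any k-subset of [k+r].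
  have hI : Icc (r + 1) (k + r) ∈ 𝓕 := by
    refine h.exchange hF hFl.1 hIn (hIc.trans hFl.2.symm) fun i hi j hj => ?_
    simp only [mem_sdiff, mem_Icc] at hi hj
    have := hFr j hj.1
    omega
  rw [mem_layer] at hW
  refine h.exchange hI hIn (hW.1.trans (Icc_subset_Icc_right hkr)) (hW.2.trans hIc.symm)
    fun i hi j hj => ?_
  simp only [mem_sdiff] at hi hj
  have h1 := mem_Icc.1 (hW.1 hi.1)
  have h2 := mem_Icc.1 hj.1
  have h3 := hi.2
  rw [mem_Icc] at h3
  omega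

/-- In a shifted family with a cover of size `s`, the initial segment `[s]` is a cover. -/
theorem Shifted.inter_Icc_nonempty {n s : ℕ} {𝓕 : Finset (Finset ℕ)} (h : Shifted n 𝓕)
    (h𝓕 : ∀ F ∈ 𝓕, F ⊆ Icc 1 n) (hs : 0 < s) (hcov : coveringNumber n 𝓕 = s) :
    ∀ F ∈ 𝓕, (F ∩ Icc 1 s).Nonempty := by
  intro F hF
  have hne := Nat.nonempty_of_pos_sInf (show 0 < sInf _ from hs.trans_eq hcov.symm)
  obtain ⟨T, hT, hTc⟩ := Nat.sInf_mem hne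
  replace hTc : #T = s := hTc.trans hcov
  by_contra hemp
  rw [not_nonempty_iff_eq_empty, ← disjoint_iff_inter_eq_empty, disjoint_left] at hemp
  have hsn : s ≤ n := by
    have := card_le_card hT.1
    rw [Nat.card_Icc] at this
    omega
  -- If F misses [s], there is room to move all of F ∩ T into [s] \ T, which yields a member missing
  -- the cover T.
  have hle : #(F ∩ T) ≤ #(Icc 1 s \ T) := by
    have h1 : #(F ∩ T) ≤ #(T \ Icc 1 s) := card_le_card fun x hx => by
      rw [mem_inter] at hx
      exact mem_sdiff.2 ⟨hx.2, hemp hx.1⟩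
    rwa [card_sdiff_comm (show #T = #(Icc 1 s) by simp [hTc])] at h1
  obtain ⟨U, hU, hUc⟩ := exists_subset_card_eq hle
  have hdisj : Disjoint (F \ T) U := by
    rw [disjoint_left]
    intro x hx hxU
    exact hemp (mem_sdiff.1 hx).1 (mem_sdiff.1 (hU hxU)).1
  have hmem : (F \ T) ∪ U ∈ 𝓕 := by
    refine h.exchange hF (h𝓕 F hF) ?_ ?_ ?_
    · exact union_subset (sdiff_subset.trans (h𝓕 F hF))
        ((hU.trans sdiff_subset).trans (Icc_subset_Icc_right hsn))
    · rw [card_union_of_disjoint hdisj, hUc, card_sdiff_add_card_inter]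
    · intro i hi j hj
      simp only [mem_sdiff, mem_union] at hi hj
      have hiU : i ∈ U := by tauto
      have h1 := mem_Icc.1 (mem_sdiff.1 (hU hiU)).1
      have h2 := hemp hj.1
      have h3 := mem_Icc.1 (h𝓕 F hF hj.1)
      rw [mem_Icc] at h2
      omega
  obtain ⟨x, hx⟩ := hT.2 _ hmem
  simp only [mem_inter, mem_union, mem_sdiff] at hx
  rcases hx with ⟨hx | hx, hxT⟩
  · exact hx.2 hxT
  · exact (mem_sdiff.1 (hU hx)).2 hxT

/-- A set meeting every `k`-subset of `[k + r]` has more than `r` elements there. -/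
theorem lt_card_inter_of_meets {k r : ℕ} {A : Finset ℕ}
    (h : ∀ W ∈ layer (k + r) k, (A ∩ W).Nonempty) : r < #(A ∩ Icc 1 (k + r)) := by
  by_contra! hle
  have hk : k ≤ #(Icc 1 (k + r) \ A) := by
    have := card_sdiff_add_card_inter (Icc 1 (k + r)) A
    rw [inter_comm, Nat.card_Icc] at this
    omega
  obtain ⟨W, hW, hWc⟩ := exists_subset_card_eq hk
  obtain ⟨x, hx⟩ := h W (mem_layer.2 ⟨hW.trans sdiff_subset, hWc⟩)
  rw [mem_inter] at hx
  exact (mem_sdiff.1 (hW hx.2)).2 hx.1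

/-! ### Deletions and links -/

section Split

variable {n a b : ℕ} {P : Finset ℕ → Prop} [DecidablePred P]

theorem nonMemberSubfamily_filter_layer (n a : ℕ) (P : Finset ℕ → Prop) [DecidablePred P] :
    ((layer (n + 1) a).filter P).nonMemberSubfamily (n + 1) = (layer n a).filter P := by
  ext A
  simp only [mem_nonMemberSubfamily, mem_filter, mem_layer]
  constructor
  · rintro ⟨⟨⟨h1, h2⟩, h3⟩, h4⟩
    refine ⟨⟨fun x hx => ?_, h2⟩, h3⟩
    have hx1 := mem_Icc.1 (h1 hx)
    have : x ≠ n + 1 := fun h => h4 (h ▸ hx)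
    exact mem_Icc.2 (by omega)
  · rintro ⟨⟨h1, h2⟩, h3⟩
    refine ⟨⟨⟨h1.trans (Icc_subset_Icc_right (by omega)), h2⟩, h3⟩, fun hc => ?_⟩
    have := mem_Icc.1 (h1 hc)
    omega

theorem memberSubfamily_filter_layer (n a : ℕ) (P : Finset ℕ → Prop) [DecidablePred P]
    (hP : ∀ A, P (insert (n + 1) A) ↔ P A) :
    ((layer (n + 1) (a + 1)).filter P).memberSubfamily (n + 1) = (layer n a).filter P := by
  ext A
  simp only [mem_memberSubfamily, mem_filter, mem_layer, hP]
  constructor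
  · rintro ⟨⟨⟨h1, h2⟩, h3⟩, h4⟩
    rw [card_insert_of_notMem h4] at h2
    refine ⟨⟨fun x hx => ?_, by omega⟩, h3⟩
    have hx1 := mem_Icc.1 (h1 (mem_insert_of_mem hx))
    have : x ≠ n + 1 := fun h => h4 (h ▸ hx)
    exact mem_Icc.2 (by omega)
  · rintro ⟨⟨h1, h2⟩, h3⟩
    have h4 : n + 1 ∉ A := fun hc => by
      have := mem_Icc.1 (h1 hc)
      omega
    refine ⟨⟨⟨insert_subset (mem_Icc.2 (by omega)) (h1.trans (Icc_subset_Icc_right (by omega))),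
      ?_⟩, h3⟩, h4⟩
    rw [card_insert_of_notMem h4, h2]

theorem card_filter_layer_succ (n a : ℕ) (P : Finset ℕ → Prop) [DecidablePred P]
    (hP : ∀ A, P (insert (n + 1) A) ↔ P A) :
    #((layer (n + 1) (a + 1)).filter P) =
      #((layer n a).filter P) + #((layer n (a + 1)).filter P) := by
  rw [← card_memberSubfamily_add_card_nonMemberSubfamily (n + 1) ((layer (n + 1) (a + 1)).filter P),
    memberSubfamily_filter_layer n a P hP, nonMemberSubfamily_filter_layer]

/-- A cross-intersecting pair of shifted uniform families, the first one satisfying `P`. -/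
structure ShiftedPair (n a b : ℕ) (P : Finset ℕ → Prop) [DecidablePred P]
    (𝓕 𝓖 : Finset (Finset ℕ)) : Prop where
  left : 𝓕 ⊆ (layer n a).filter P
  right : 𝓖 ⊆ layer n b
  shifted_left : Shifted n 𝓕
  shifted_right : Shifted n 𝓖
  cross : CrossIntersecting 𝓕 𝓖

theorem Shifted.nonMemberSubfamily {𝓕 : Finset (Finset ℕ)} (h : Shifted (n + 1) 𝓕) :
    Shifted n (𝓕.nonMemberSubfamily (n + 1)) := by
  intro F hF i j hi hij hj hjF hiF
  rw [mem_nonMemberSubfamily] at hF ⊢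
  refine ⟨h F hF.1 i j hi hij (by omega) hjF hiF, fun hc => ?_⟩
  rcases mem_insert.1 hc with hc | hc
  · omega
  · exact hF.2 (mem_of_mem_erase hc)

theorem Shifted.memberSubfamily {𝓕 : Finset (Finset ℕ)} (h : Shifted (n + 1) 𝓕) :
    Shifted n (𝓕.memberSubfamily (n + 1)) := by
  intro F hF i j hi hij hj hjF hiF
  rw [mem_memberSubfamily] at hF ⊢
  have h1 := h _ hF.1 i j hi hij (by omega) (mem_insert_of_mem hjF) (fun hc => by
    rcases mem_insert.1 hc with hc | hc
    · omega
    · exact hiF hc)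
  constructor
  · rwa [erase_insert_of_ne (by omega), Finset.insert_comm] at h1
  · intro hc
    rcases mem_insert.1 hc with hc | hc
    · omega
    · exact hF.2 (mem_of_mem_erase hc)

theorem memberSubfamily_mono {x : ℕ} {𝓐 𝓑 : Finset (Finset ℕ)} (h : 𝓐 ⊆ 𝓑) :
    𝓐.memberSubfamily x ⊆ 𝓑.memberSubfamily x := fun A hA => by
  rw [mem_memberSubfamily] at hA ⊢
  exact ⟨h hA.1, hA.2⟩

theorem nonMemberSubfamily_mono {x : ℕ} {𝓐 𝓑 : Finset (Finset ℕ)} (h : 𝓐 ⊆ 𝓑) :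
    𝓐.nonMemberSubfamily x ⊆ 𝓑.nonMemberSubfamily x := fun A hA => by
  rw [mem_nonMemberSubfamily] at hA ⊢
  exact ⟨h hA.1, hA.2⟩

theorem ShiftedPair.deletion {𝓕 𝓖 : Finset (Finset ℕ)} (h : ShiftedPair (n + 1) a b P 𝓕 𝓖) :
    ShiftedPair n a b P (𝓕.nonMemberSubfamily (n + 1)) (𝓖.nonMemberSubfamily (n + 1)) where
  left := (nonMemberSubfamily_mono h.left).trans (nonMemberSubfamily_filter_layer n a P).subset
  right := by
    have := nonMemberSubfamily_filter_layer n b (fun _ => True)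
    rw [filter_true, filter_true] at this
    exact (nonMemberSubfamily_mono h.right).trans this.subset
  shifted_left := h.shifted_left.nonMemberSubfamily
  shifted_right := h.shifted_right.nonMemberSubfamily
  cross := fun F hF G hG =>
    h.cross F (mem_nonMemberSubfamily.1 hF).1 G (mem_nonMemberSubfamily.1 hG).1

/-- Only cross-intersection is at stake: two link members might meet in n+1 alone. As a+b < n, some
x in [n] lies in neither; shifting n+1 to x in the first forces a common point other than n+1. -/
theorem ShiftedPair.link {𝓕 𝓖 : Finset (Finset ℕ)}
    (h : ShiftedPair (n + 1) (a + 1) (b + 1) P 𝓕 𝓖) (hP : ∀ A, P (insert (n + 1) A) ↔ P A)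
    (hn : a + b < n) :
    ShiftedPair n a b P (𝓕.memberSubfamily (n + 1)) (𝓖.memberSubfamily (n + 1)) := by
  have hleft := (memberSubfamily_mono (x := n + 1) h.left).trans
    (memberSubfamily_filter_layer n a P hP).subset
  have hright : 𝓖.memberSubfamily (n + 1) ⊆ layer n b := by
    have := memberSubfamily_filter_layer n b (fun _ => True) (fun _ => Iff.rfl)
    rw [filter_true, filter_true] at this
    exact (memberSubfamily_mono h.right).trans this.subset
  refine ⟨hleft, hright, h.shifted_left.memberSubfamily, h.shifted_right.memberSubfamily, ?_⟩
  intro F hF G hG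
  have hFl := mem_layer.1 (mem_filter.1 (hleft hF)).1
  have hGl := mem_layer.1 (hright hG)
  rw [mem_memberSubfamily] at hF hG
  obtain ⟨x, hx, hxFG⟩ : ∃ x ∈ Icc 1 n, x ∉ F ∪ G := by
    by_contra! hcon
    have h1 := card_le_card (fun x hx => hcon x hx : Icc 1 n ⊆ F ∪ G)
    have h2 := card_union_le F G
    rw [Nat.card_Icc] at h1
    omega
  rw [mem_union, not_or] at hxFG
  rw [mem_Icc] at hx
  have h1 := h.shifted_left _ hF.1 x (n + 1) hx.1 (by omega) le_rfl (mem_insert_self _ _)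
    (fun hc => by
      rcases mem_insert.1 hc with hc | hc
      · omega
      · exact hxFG.1 hc)
  rw [erase_insert hF.2] at h1
  obtain ⟨y, hy⟩ := h.cross _ h1 _ hG.1
  refine ⟨y, ?_⟩
  simp only [mem_inter, mem_insert] at hy ⊢
  obtain ⟨rfl | hyF, rfl | hyG⟩ := hy
  · omega
  · exact absurd hyG hxFG.2
  · exact absurd hyF hF.2
  · exact ⟨hyF, hyG⟩

/-- The bound when the two uniformities add up to the size of the ground set, by complementation. -/
theorem ShiftedPair.card_add_card_le_of_eq {𝓕 𝓖 : Finset (Finset ℕ)} {Q : Finset ℕ → Prop}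
    [DecidablePred Q] (h : ShiftedPair n a b P 𝓕 𝓖) (hn : a + b = n)
    (hPQ : ∀ B ∈ layer n b, ¬ Q B → P (Icc 1 n \ B)) :
    #𝓕 + #𝓖 ≤ #((layer n a).filter P) + #((layer n b).filter Q) := by
  have h1 : #(𝓖.filter Q) ≤ #((layer n b).filter Q) := card_le_card (filter_subset_filter _ h.right)
  have h2 : #(𝓖.filter fun B => ¬ Q B) ≤ #((layer n a).filter P \ 𝓕) := by
    -- A member of 𝓖 is disjoint from its complement, so that complement is not in 𝓕.
    refine card_le_card_of_injOn (fun B => Icc 1 n \ B) ?_ ?_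
    · intro B hB
      simp only [coe_filter, Set.mem_ofPred_eq] at hB
      have hBl := mem_layer.1 (h.right hB.1)
      simp only [coe_sdiff, Set.mem_sdiff, mem_coe, mem_filter, mem_layer]
      refine ⟨⟨⟨sdiff_subset, ?_⟩, hPQ B (h.right hB.1) hB.2⟩, fun hc => ?_⟩
      · rw [card_sdiff_of_subset hBl.1, Nat.card_Icc]
        omega
      · obtain ⟨x, hx⟩ := h.cross _ hc B hB.1
        simp only [mem_inter, mem_sdiff] at hx
        exact hx.1.2 hx.2
    · intro B hB B' hB' heq
      simp only [coe_filter, Set.mem_ofPred_eq] at hB hB'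
      have hBl := mem_layer.1 (h.right hB.1)
      have hBl' := mem_layer.1 (h.right hB'.1)
      have heq' : Icc 1 n \ B = Icc 1 n \ B' := heq
      rw [← inter_eq_right.2 hBl.1, ← inter_eq_right.2 hBl'.1, ← sdiff_sdiff_self_left, heq',
        sdiff_sdiff_self_left]
  have h3 := card_filter_add_card_filter_not (s := 𝓖) Q
  have h4 := card_sdiff_add_card_eq_card h.left
  omega

theorem ShiftedPair.card_le_of_zero {𝓕 𝓖 : Finset (Finset ℕ)} (h : ShiftedPair n a 0 P 𝓕 𝓖)
    (hne : ∅ ∈ 𝓖 → ((layer n a).filter P).Nonempty) : #𝓕 + #𝓖 ≤ #((layer n a).filter P) := by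
  have hG : 𝓖 ⊆ {∅} := fun B hB => by
    have := (mem_layer.1 (h.right hB)).2
    rw [card_eq_zero] at this
    simp [this]
  by_cases h0 : ∅ ∈ 𝓖
  · have hF : 𝓕 = ∅ := by
      refine eq_empty_of_forall_notMem fun F hF => ?_
      simpa using h.cross F hF ∅ h0
    have h1 := card_le_card hG
    have h2 := card_pos.2 (hne h0)
    rw [card_singleton] at h1
    rw [hF, card_empty]
    omega
  · have hG0 : 𝓖 = ∅ := by
      refine eq_empty_of_forall_notMem fun B hB => h0 ?_
      have := mem_singleton.1 (hG hB)
      rwa [this] at hB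
    rw [hG0, card_empty]
    exact card_le_card h.left

end Split

/-- Serves the range where [s] covers the ground set and meeting it is no restriction. At n = a+b,
complements of members of 𝓖 are a-sets missing from 𝓕. -/
theorem card_add_card_le_layer {n a b : ℕ} {𝓕 𝓖 : Finset (Finset ℕ)}
    (h : ShiftedPair n a b (fun _ => True) 𝓕 𝓖) (hab : b ≤ a) (hn : a + b ≤ n) :
    #𝓕 + #𝓖 ≤ #(layer n a) := by
  induction n generalizing a b 𝓕 𝓖 with
  | zero =>
    have h1 := h.card_add_card_le_of_eq (Q := fun _ => False) (by omega) (fun _ _ _ => trivial)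
    simpa using h1
  | succ n ih =>
    rcases b with _ | b
    · have h1 := h.card_le_of_zero (fun _ => by
        rw [filter_true, layer, powersetCard_nonempty, Nat.card_Icc]
        omega)
      rwa [filter_true] at h1
    obtain ⟨a, rfl⟩ : ∃ a', a = a' + 1 := ⟨a - 1, by omega⟩
    rcases hn.eq_or_lt with hn | hn
    · have h1 := h.card_add_card_le_of_eq (Q := fun _ => False) hn (fun _ _ _ => trivial)
      simpa using h1
    · have h1 := ih h.deletion hab (by omega)
      have h2 := ih (h.link (fun _ => Iff.rfl) (by omega)) (by omega) (by omega)
      have h3 := card_filter_layer_succ n a (fun _ => True) (fun _ => Iff.rfl)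
      rw [filter_true, filter_true, filter_true] at h3
      have h4 := card_memberSubfamily_add_card_nonMemberSubfamily (n + 1) 𝓕
      have h5 := card_memberSubfamily_add_card_nonMemberSubfamily (n + 1) 𝓖
      omega

/-! ### The extremal pair -/

/-- The condition defining the larger sets of the extremal family. -/
abbrev Large (s c t : ℕ) (A : Finset ℕ) : Prop :=
  (A ∩ Icc 1 s).Nonempty ∧ t ≤ #(A ∩ Icc 1 c)

/-- The condition on a set forcing it to meet all sets that are `Large`. -/
abbrev Small (s c t : ℕ) (B : Finset ℕ) : Prop :=
  Icc 1 s ⊆ B ∨ c + 1 ≤ #(B ∩ Icc 1 c) + t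

theorem large_insert {n s c t : ℕ} (hs : s ≤ n) (hc : c ≤ n) (A : Finset ℕ) :
    Large s c t (insert (n + 1) A) ↔ Large s c t A := by
  rw [Large, Large, insert_inter_of_notMem (by simp; omega),
    insert_inter_of_notMem (by simp; omega)]

theorem small_insert {n s c t : ℕ} (hs : s ≤ n) (hc : c ≤ n) (B : Finset ℕ) :
    Small s c t (insert (n + 1) B) ↔ Small s c t B := by
  rw [Small, Small, insert_inter_of_notMem (by simp; omega),
    subset_insert_iff_of_notMem (by simp; omega)]

theorem large_compl {n s c t : ℕ} (hs : s ≤ n) (hc : c ≤ n) {B : Finset ℕ}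
    (hB : ¬ Small s c t B) : Large s c t (Icc 1 n \ B) := by
  rw [Small, not_or, not_subset] at hB
  obtain ⟨⟨x, hx, hxB⟩, h2⟩ := hB
  refine ⟨⟨x, ?_⟩, ?_⟩
  · have := mem_Icc.1 hx
    simp only [mem_inter, mem_sdiff, mem_Icc]
    exact ⟨⟨by omega, hxB⟩, this⟩
  · have h3 : (Icc 1 n \ B) ∩ Icc 1 c = Icc 1 c \ B := by
      ext x
      simp only [mem_inter, mem_sdiff, mem_Icc]
      constructor
      · rintro ⟨⟨_, h⟩, h'⟩
        exact ⟨h', h⟩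
      · rintro ⟨h, h'⟩
        exact ⟨⟨by omega, h'⟩, h⟩
    have h4 := card_sdiff_add_card_inter (Icc 1 c) B
    rw [Nat.card_Icc, inter_comm] at h4
    rw [h3]
    omega

theorem Icc_mem_filter_large {n a s c t : ℕ} (ha : 1 ≤ a) (han : a ≤ n) (hs : 1 ≤ s)
    (hta : t ≤ a) (htc : t ≤ c) : Icc 1 a ∈ (layer n a).filter (Large s c t) := by
  simp only [mem_filter, mem_layer]
  refine ⟨⟨Icc_subset_Icc_right han, by simp⟩, ⟨1, by simp; omega⟩, ?_⟩
  have h1 : Icc 1 t ⊆ Icc 1 a ∩ Icc 1 c :=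
    subset_inter (Icc_subset_Icc_right hta) (Icc_subset_Icc_right htc)
  simpa using card_le_card h1

/-- One induction step: the bounds for the deletion and the link add up. -/
theorem card_add_card_le_succ {n a b : ℕ} {P Q : Finset ℕ → Prop} [DecidablePred P]
    [DecidablePred Q] {𝓕 𝓖 : Finset (Finset ℕ)} (hP : ∀ A, P (insert (n + 1) A) ↔ P A)
    (hQ : ∀ A, Q (insert (n + 1) A) ↔ Q A)
    (h1 : #(𝓕.nonMemberSubfamily (n + 1)) + #(𝓖.nonMemberSubfamily (n + 1)) ≤
      #((layer n (a + 1)).filter P) + #((layer n (b + 1)).filter Q))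
    (h2 : #(𝓕.memberSubfamily (n + 1)) + #(𝓖.memberSubfamily (n + 1)) ≤
      #((layer n a).filter P) + #((layer n b).filter Q)) :
    #𝓕 + #𝓖 ≤ #((layer (n + 1) (a + 1)).filter P) + #((layer (n + 1) (b + 1)).filter Q) := by
  have h3 := card_filter_layer_succ n a P hP
  have h3' := card_filter_layer_succ n b Q hQ
  have h4 := card_memberSubfamily_add_card_nonMemberSubfamily (n + 1) 𝓕
  have h5 := card_memberSubfamily_add_card_nonMemberSubfamily (n + 1) 𝓖
  omega

/-- With c = t = 0 the counting conditions disappear: `Large` means meeting [s], `Small` means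
containing [s]. This is what remains once [c] fills the ground set. -/
theorem card_add_card_le_of_meets {n a b s : ℕ} {𝓕 𝓖 : Finset (Finset ℕ)}
    (h : ShiftedPair n a b (Large s 0 0) 𝓕 𝓖) (hs : 1 ≤ s) (hab : b < a) (hn : a + b ≤ n) :
    #𝓕 + #𝓖 ≤ #((layer n a).filter (Large s 0 0)) + #((layer n b).filter (Small s 0 0)) := by
  induction n generalizing a b 𝓕 𝓖 with
  | zero => omega
  | succ n ih =>
    rcases le_or_gt (n + 1) s with hns | hns
    · have h0 : (layer (n + 1) a).filter (Large s 0 0) = layer (n + 1) a := by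
        refine filter_true_of_mem fun A hA => ?_
        rw [mem_layer] at hA
        refine ⟨?_, Nat.zero_le _⟩
        rw [inter_eq_left.2 (hA.1.trans (Icc_subset_Icc_right hns)), ← card_pos]
        omega
      have h1 : ShiftedPair (n + 1) a b (fun _ => True) 𝓕 𝓖 :=
        ⟨by rw [filter_true]; exact h.left.trans (filter_subset _ _), h.right, h.shifted_left,
          h.shifted_right, h.cross⟩
      have h2 := card_add_card_le_layer h1 hab.le hn
      rw [h0]
      omega
    rcases b with _ | b
    · have := h.card_le_of_zero
        fun _ => ⟨_, Icc_mem_filter_large hab (by omega) hs (by omega) le_rfl⟩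
      omega
    obtain ⟨a, rfl⟩ : ∃ a', a = a' + 1 := ⟨a - 1, by omega⟩
    rcases hn.eq_or_lt with hn | hn
    · exact h.card_add_card_le_of_eq hn fun B _ hB => large_compl hns.le (by omega) hB
    · exact card_add_card_le_succ (large_insert (by omega) (by omega))
        (small_insert (by omega) (by omega)) (ih h.deletion hab (by omega))
        (ih (h.link (large_insert (by omega) (by omega)) (by omega)) (by omega) (by omega))

/-- The hypothesis `hmeet` protects the boundary a+1 = b+t. There b = 0 gives a = t-1, so no a-set
is `Large` and the bound is 0, which 𝓖 = {∅} would violate. It is stable under deletion and link,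
since both b and a drop together. -/
theorem card_add_card_le {n a b s c t : ℕ} {𝓕 𝓖 : Finset (Finset ℕ)}
    (h : ShiftedPair n a b (Large s c t) 𝓕 𝓖) (hs : 1 ≤ s) (hsc : s ≤ c) (ht : 1 < t)
    (htc : t ≤ c) (hcn : c ≤ n) (hab : b + t ≤ a + 1) (hn : a + b ≤ n)
    (hmeet : a + 1 = b + t → ∀ B ∈ 𝓖, (B ∩ Icc 1 c).Nonempty) :
    #𝓕 + #𝓖 ≤ #((layer n a).filter (Large s c t)) + #((layer n b).filter (Small s c t)) := by
  induction n generalizing a b 𝓕 𝓖 with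
  | zero => omega
  | succ n ih =>
    rcases b with _ | b
    · have := h.card_le_of_zero fun h0 => by
        have hta : a + 1 ≠ 0 + t := fun heq => by
          simpa using hmeet heq ∅ h0
        exact ⟨_, Icc_mem_filter_large (by omega) (by omega) hs (by omega) htc⟩
      omega
    obtain ⟨a, rfl⟩ : ∃ a', a = a' + 1 := ⟨a - 1, by omega⟩
    rcases hcn.eq_or_lt with hcn | hcn
    · have h0 : (layer (n + 1) (a + 1)).filter (Large s 0 0) ⊆
          (layer (n + 1) (a + 1)).filter (Large s c t) := by
        intro A hA
        rw [mem_filter] at hA ⊢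
        refine ⟨hA.1, hA.2.1, ?_⟩
        have hAl := mem_layer.1 hA.1
        rw [hcn, inter_eq_left.2 hAl.1]
        omega
      have h0' : (layer (n + 1) (b + 1)).filter (Small s 0 0) ⊆
          (layer (n + 1) (b + 1)).filter (Small s c t) := by
        intro B hB
        rw [mem_filter] at hB ⊢
        refine ⟨hB.1, Or.inl ?_⟩
        rcases hB.2 with h1 | h1
        · exact h1
        · simp at h1
      have h1 : ShiftedPair (n + 1) (a + 1) (b + 1) (Large s 0 0) 𝓕 𝓖 := by
        refine ⟨fun A hA => ?_, h.right, h.shifted_left, h.shifted_right, h.cross⟩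
        have := mem_filter.1 (h.left hA)
        exact mem_filter.2 ⟨this.1, this.2.1, Nat.zero_le _⟩
      have h2 := card_add_card_le_of_meets h1 hs (by omega) hn
      have h3 := card_le_card h0
      have h4 := card_le_card h0'
      omega
    rcases hn.eq_or_lt with hn | hn
    · exact h.card_add_card_le_of_eq hn fun B _ hB => large_compl (by omega) (by omega) hB
    · refine card_add_card_le_succ (large_insert (by omega) (by omega))
        (small_insert (by omega) (by omega)) (ih h.deletion (by omega) hab (by omega) ?_)
        (ih (h.link (large_insert (by omega) (by omega)) (by omega)) (by omega) (by omega)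
          (by omega) ?_)
      · exact fun heq B hB => hmeet heq B (mem_nonMemberSubfamily.1 hB).1
      · intro heq B hB
        have := hmeet (by omega) _ (mem_memberSubfamily.1 hB).1
        rwa [insert_inter_of_notMem (by simp; omega)] at this

/-! ### The equality case -/

/-- In the equality case the first family is the extremal one, provided that every member of the
second one has at least `s` elements in a short initial segment `[d]`. -/
theorem left_eq_of_card_eq {n a b s c t d : ℕ} {𝓕 𝓖 : Finset (Finset ℕ)}
    (h : ShiftedPair n a b (Large s c t) 𝓕 𝓖) (hs : 2 ≤ s) (hsc : s ≤ c) (ht : 1 < t)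
    (htc : t ≤ c) (hcd : c ≤ d) (hab : b + t ≤ a + 1) (hn : a + b < n)
    (hmeet : a + 1 = b + t → ∀ B ∈ 𝓖, (B ∩ Icc 1 c).Nonempty)
    (hsb : s ≤ b + 1) (hdn : d + b + 1 ≤ n + s) (hd : ∀ B ∈ 𝓖, s ≤ #(B ∩ Icc 1 d))
    (heq : #𝓕 + #𝓖 =
      #((layer n a).filter (Large s c t)) + #((layer n b).filter (Small s c t))) :
    𝓕 = (layer n a).filter (Large s c t) := by
  induction n generalizing a b 𝓕 𝓖 with
  | zero => omega
  | succ n ih =>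
    -- When s = b+1, a b-set cannot have s elements in [d], so 𝓖 is empty.
    rcases hsb.eq_or_lt with hsb | hsb
    · have hG : 𝓖 = ∅ := by
        refine eq_empty_of_forall_notMem fun B hB => ?_
        have h1 := hd B hB
        have h2 := card_le_card (inter_subset_left : B ∩ Icc 1 d ⊆ B)
        have h3 := (mem_layer.1 (h.right hB)).2
        omega
      rw [hG, card_empty] at heq
      exact eq_of_subset_of_card_le h.left (by omega)
    obtain ⟨a, rfl⟩ : ∃ a', a = a' + 1 := ⟨a - 1, by omega⟩
    obtain ⟨b, rfl⟩ : ∃ b', b = b' + 1 := ⟨b - 1, by omega⟩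
    have hlins := large_insert (n := n) (s := s) (c := c) (t := t) (by omega) (by omega)
    have hsins := small_insert (n := n) (s := s) (c := c) (t := t) (by omega) (by omega)
    have hlink := h.link hlins (by omega)
    have hmeet' : a + 1 = b + t →
        ∀ B ∈ 𝓖.memberSubfamily (n + 1), (B ∩ Icc 1 c).Nonempty := by
      intro heq B hB
      have := hmeet (by omega) _ (mem_memberSubfamily.1 hB).1
      rwa [insert_inter_of_notMem (by simp; omega)] at this
    have h1 := card_add_card_le h.deletion (by omega) hsc ht htc (by omega) hab (by omega)
      (fun heq B hB => hmeet heq B (mem_nonMemberSubfamily.1 hB).1)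
    have h2 := card_add_card_le hlink (by omega) hsc ht htc (by omega) (by omega) (by omega) hmeet'
    have h3 := card_filter_layer_succ n a _ hlins
    have h3' := card_filter_layer_succ n b _ hsins
    have h4 := card_memberSubfamily_add_card_nonMemberSubfamily (n + 1) 𝓕
    have h5 := card_memberSubfamily_add_card_nonMemberSubfamily (n + 1) 𝓖
    -- Both bounds `h1` and `h2` must be tight. Since s ≤ b+1 here, `hdn` gives d ≤ n, so removing
    -- n+1 does not affect the count in [d].
    have hF := ih hlink (by omega) (by omega) hmeet' (by omega) (by omega) (fun B hB => by
      have := hd _ (mem_memberSubfamily.1 hB).1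
      rwa [insert_inter_of_notMem (by simp; omega)] at this) (by omega)
    refine h.left.antisymm fun A hA => ?_
    obtain ⟨hAl, hAs, hAt⟩ := mem_filter.1 hA
    rw [mem_layer] at hAl
    have hAne : A.Nonempty := card_pos.1 (by omega)
    -- Removing the maximum keeps A `Large`: if it lies in [s] or in [c], so do all remaining
    -- elements, and at least t of them remain.
    set m := A.max' hAne with hm
    have hmA : m ∈ A := max'_mem A hAne
    have hmn := mem_Icc.1 (hAl.1 hmA)
    have hmem : A.erase m ∈ 𝓕.memberSubfamily (n + 1) := by
      rw [hF, mem_filter, mem_layer]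
      have hlt : ∀ x ∈ A.erase m, x < m := fun x hx =>
        lt_max'_of_mem_erase_max' A hAne hx
      refine ⟨⟨fun x hx => ?_, by rw [card_erase_of_mem hmA, hAl.2]; rfl⟩, ?_, ?_⟩
      · have h6 := hlt x hx
        have h7 := mem_Icc.1 (hAl.1 (mem_of_mem_erase hx))
        exact mem_Icc.2 (by omega)
      · obtain ⟨x, hx⟩ := hAs
        rw [mem_inter, mem_Icc] at hx
        obtain ⟨y, hy⟩ : (A.erase m).Nonempty := card_pos.1 (by
          rw [card_erase_of_mem hmA]; omega)
        by_cases hxm : x = m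
        · have h6 := hlt y hy
          have h7 := mem_Icc.1 (hAl.1 (mem_of_mem_erase hy))
          exact ⟨y, mem_inter.2 ⟨hy, mem_Icc.2 (by omega)⟩⟩
        · exact ⟨x, mem_inter.2 ⟨mem_erase.2 ⟨hxm, hx.1⟩, mem_Icc.2 hx.2⟩⟩
      · by_cases hmc : m ≤ c
        · rw [inter_eq_left.2, card_erase_of_mem hmA]
          · omega
          · intro x hx
            have h6 := hlt x hx
            have h7 := mem_Icc.1 (hAl.1 (mem_of_mem_erase hx))
            exact mem_Icc.2 (by omega)
        · rwa [erase_inter, erase_eq_of_notMem]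
          simp only [mem_inter, mem_Icc]
          omega
    rw [mem_memberSubfamily] at hmem
    by_cases hmn' : m = n + 1
    · rw [← hmn', insert_erase hmA] at hmem
      exact hmem.1
    -- The link places A with m replaced by n+1 in 𝓕; shifting n+1 back to m recovers A.
    · have h6 := h.shifted_left _ hmem.1 m (n + 1) hmn.1 (by omega) le_rfl (mem_insert_self _ _)
        (by simp [hmn'])
      rwa [erase_insert hmem.2, insert_erase hmA] at h6

/-! ### The extremal family and isomorphism -/

theorem extremalFamily_eq {n a b s t : ℕ} (hb : 1 ≤ b) (ht : 1 ≤ t) (hn : b + t - 1 ≤ n) :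
    extremalFamily n a b s t = (layer n a).filter (Large s (b + t - 1) t) ∪
      (layer n b).filter (Small s (b + t - 1) t) := by
  rw [extremalFamily, union_assoc]
  congr 1
  ext B
  simp only [mem_union, mem_filter]
  constructor
  · rintro (⟨h1, h2⟩ | h)
    · exact ⟨h1, Or.inl h2⟩
    · refine ⟨layer_mono hn b h, Or.inr ?_⟩
      rw [mem_layer] at h
      rw [inter_eq_left.2 h.1]
      omega
  · rintro ⟨h1, h2 | h2⟩
    · exact Or.inl ⟨h1, h2⟩
    · right
      rw [mem_layer] at h1 ⊢
      have h3 : B ∩ Icc 1 (b + t - 1) = B :=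
        eq_of_subset_of_card_le inter_subset_left (by omega)
      exact ⟨inter_eq_left.1 h3, h1.2⟩

theorem disjoint_of_subset_layer {n a b : ℕ} {𝓕 𝓖 : Finset (Finset ℕ)} (h𝓕 : 𝓕 ⊆ layer n a)
    (h𝓖 : 𝓖 ⊆ layer n b) (hab : a ≠ b) : Disjoint 𝓕 𝓖 := by
  rw [disjoint_left]
  intro A hA hA'
  exact hab ((mem_layer.1 (h𝓕 hA)).2.symm.trans (mem_layer.1 (h𝓖 hA')).2)

theorem Isomorphic.card_eq {n : ℕ} {𝓕 𝓗 : Finset (Finset ℕ)} (h : Isomorphic n 𝓕 𝓗)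
    (h𝓕 : ∀ F ∈ 𝓕, F ⊆ Icc 1 n) : #𝓕 = #𝓗 := by
  obtain ⟨σ, hσ, rfl⟩ := h
  refine (card_image_of_injOn fun A hA B hB hAB => ?_).symm
  have hA' : (A : Set ℕ) ⊆ Set.Icc 1 n := by
    rw [← coe_Icc]; exact_mod_cast h𝓕 A hA
  have hB' : (B : Set ℕ) ⊆ Set.Icc 1 n := by
    rw [← coe_Icc]; exact_mod_cast h𝓕 B hB
  have hAB' : A.image σ = B.image σ := hAB
  have h1 : σ '' (A : Set ℕ) = σ '' (B : Set ℕ) := by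
    rw [← coe_image, ← coe_image, hAB']
  exact_mod_cast (hσ.injOn.image_eq_image_iff hA' hB').1 h1

theorem Isomorphic.refl (n : ℕ) (𝓕 : Finset (Finset ℕ)) : Isomorphic n 𝓕 𝓕 :=
  ⟨id, Set.bijOn_id _, by simp⟩

/-- Sets meeting all large sets are small. -/
theorem small_of_meets {n a b s c t : ℕ} (hsc : s ≤ c) (hc : c ≤ n) (ht : 1 ≤ t) (hta : t ≤ a)
    (hn : a + b ≤ n) {B : Finset ℕ} (hB : B ∈ layer n b)
    (hmeet : ∀ A ∈ (layer n a).filter (Large s c t), (A ∩ B).Nonempty) : Small s c t B := by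
  by_contra hcon
  obtain ⟨⟨x, hx⟩, h2⟩ := large_compl (hsc.trans hc) hc hcon
  rw [mem_layer] at hB
  have hxs := (mem_inter.1 hx).2
  have hxc : x ∈ (Icc 1 n \ B) ∩ Icc 1 c :=
    mem_inter.2 ⟨(mem_inter.1 hx).1, Icc_subset_Icc_right hsc hxs⟩
  -- Inside the complement of B, a t-subset of [c] through a point of [s] extends to a `Large` a-set
  -- disjoint from B.
  obtain ⟨T, hxT, hTc, hTt⟩ := exists_subsuperset_card_eq (singleton_subset_iff.2 hxc)
    (by rwa [card_singleton]) h2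
  have hcard : a ≤ #(Icc 1 n \ B) := by
    rw [card_sdiff_of_subset hB.1, Nat.card_Icc]
    omega
  obtain ⟨A, hTA, hAn, hAa⟩ := exists_subsuperset_card_eq (hTc.trans inter_subset_left)
    (hTt.trans_le hta) hcard
  obtain ⟨y, hy⟩ := hmeet A (mem_filter.2 ⟨mem_layer.2 ⟨hAn.trans sdiff_subset, hAa⟩,
    ⟨x, mem_inter.2 ⟨hTA (singleton_subset_iff.1 hxT), hxs⟩⟩,
    hTt.ge.trans (card_le_card (subset_inter hTA (hTc.trans inter_subset_right)))⟩)
  rw [mem_inter] at hy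
  exact (mem_sdiff.1 (hAn hy.1)).2 hy.2

end CrossFamilies

open CrossFamilies in
theorem mainTheorem6 (n a b s t : ℕ) (𝓕 𝓖 : Finset (Finset ℕ))
    (h𝓕 : 𝓕 ⊆ CrossFamilies.layer n a) (h𝓖 : 𝓖 ⊆ CrossFamilies.layer n b)
    (hinit𝓕 : CrossFamilies.IsInitial n 𝓕) (hinit𝓖 : CrossFamilies.IsInitial n 𝓖)
    (hcross : CrossFamilies.CrossIntersecting 𝓕 𝓖)
    (hab : b + t - 1 ≤ a) (hb : 2 ≤ b) (hn : a + b ≤ n)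
    (hτ : (CrossFamilies.coveringNumber n 𝓕 = s ∧ 2 ≤ s ∧
            t ≤ CrossFamilies.coveringNumber n 𝓖 ∧ 2 ≤ t) ∨
          (CrossFamilies.coveringNumber n 𝓕 = s ∧ 2 ≤ s ∧
            CrossFamilies.coveringNumber n 𝓖 = t ∧ 2 ≤ t)) :
    𝓕.card + 𝓖.card ≤ (CrossFamilies.extremalFamily n a b s t).card ∧
    (a + b < n →
      (𝓕.card + 𝓖.card = (CrossFamilies.extremalFamily n a b s t).card ↔
        CrossFamilies.Isomorphic n (𝓕 ∪ 𝓖) (CrossFamilies.extremalFamily n a b s t))) := by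
  -- The second alternative is a special case of the first.
  obtain ⟨hτ𝓕, hs, hτ𝓖, ht⟩ : coveringNumber n 𝓕 = s ∧ 2 ≤ s ∧ t ≤ coveringNumber n 𝓖 ∧ 2 ≤ t := by
    rcases hτ with h | ⟨h1, h2, h3, h4⟩
    · exact h
    · exact ⟨h1, h2, h3.ge, h4⟩
  have hsh𝓕 := hinit𝓕.shifted
  have hsh𝓖 := hinit𝓖.shifted
  obtain ⟨-, hF⟩ := hsh𝓕.layer_subset_of_lt_coveringNumber (r := s - 1) h𝓕 (by omega)
  obtain ⟨-, hG⟩ := hsh𝓖.layer_subset_of_lt_coveringNumber (r := t - 1) h𝓖 (by omega)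
  have hmeets := hsh𝓕.inter_Icc_nonempty (fun F hF => (mem_layer.1 (h𝓕 hF)).1) (by omega) hτ𝓕
  have hFt : ∀ F ∈ 𝓕, t ≤ (F ∩ Finset.Icc 1 (b + t - 1)).card := fun F hF => by
    have h1 := lt_card_inter_of_meets fun W hW => hcross F hF W (hG hW)
    rw [← Nat.add_sub_assoc (by omega)] at h1
    omega
  have hGs : ∀ G ∈ 𝓖, s ≤ (G ∩ Finset.Icc 1 (a + s - 1)).card := fun G hG => by
    have h1 := lt_card_inter_of_meets fun W hW => by
      have h2 := hcross W (hF hW) G hG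
      rwa [Finset.inter_comm] at h2
    rw [← Nat.add_sub_assoc (by omega)] at h1
    omega
  have hIcc : Finset.Icc 1 b ∈ 𝓖 :=
    hG (mem_layer.2 ⟨Finset.Icc_subset_Icc_right (by omega), by simp⟩)
  -- The member [b] of 𝓖 has at least s elements.
  have hsb : s ≤ b := by
    have h1 := (hGs _ hIcc).trans (Finset.card_le_card Finset.inter_subset_left)
    simpa using h1
  have hpair : ShiftedPair n a b (Large s (b + t - 1) t) 𝓕 𝓖 :=
    ⟨fun F hF => Finset.mem_filter.2 ⟨h𝓕 hF, hmeets F hF, hFt F hF⟩, h𝓖, hsh𝓕, hsh𝓖, hcross⟩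
  have hIcc' : Finset.Icc 1 a ∈ 𝓕 :=
    hF (mem_layer.2 ⟨Finset.Icc_subset_Icc_right (by omega), by simp⟩)
  have hmeet : a + 1 = b + t → ∀ B ∈ 𝓖, (B ∩ Finset.Icc 1 (b + t - 1)).Nonempty := by
    intro heq B hB
    have h1 := hcross _ hIcc' B hB
    rwa [Finset.inter_comm, show a = b + t - 1 by omega] at h1
  have hcard : (extremalFamily n a b s t).card = ((layer n a).filter (Large s (b + t - 1) t)).card +
      ((layer n b).filter (Small s (b + t - 1) t)).card := by
    rw [extremalFamily_eq (by omega) (by omega) (by omega), Finset.card_union_of_disjoint]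
    exact disjoint_of_subset_layer (Finset.filter_subset _ _) (Finset.filter_subset _ _) (by omega)
  refine ⟨?_, fun hn' => ⟨fun heq => ?_, fun hiso => ?_⟩⟩
  · rw [hcard]
    exact card_add_card_le hpair (by omega) (by omega) ht (by omega) (by omega) (by omega) hn hmeet
  · rw [hcard] at heq
    -- Here d = a+s-1, the segment all of whose a-subsets lie in 𝓕.
    have hFeq := left_eq_of_card_eq hpair hs (by omega) ht (by omega)
      (show b + t - 1 ≤ a + s - 1 by omega) (by omega) hn' hmeet (by omega) (by omega) hGs heq
    have hGeq : 𝓖 = (layer n b).filter (Small s (b + t - 1) t) := by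
      refine Finset.eq_of_subset_of_card_le (fun B hB => Finset.mem_filter.2 ⟨h𝓖 hB, ?_⟩)
        (by rw [← hFeq] at heq; omega)
      exact small_of_meets (by omega) (by omega) (by omega) (by omega) hn (h𝓖 hB)
        fun A hA => hcross A (by rwa [hFeq]) B hB
    rw [extremalFamily_eq (by omega) (by omega) (by omega), ← hFeq, ← hGeq]
    exact Isomorphic.refl n _
  · rw [← hiso.card_eq, Finset.card_union_of_disjoint
      (disjoint_of_subset_layer h𝓕 h𝓖 (by omega))]
    intro F hF
    rcases Finset.mem_union.1 hF with hF | hF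
    · exact (mem_layer.1 (h𝓕 hF)).1
    · exact (mem_layer.1 (h𝓖 hF)).1
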